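/- Call a function $f:\mathbb{N}\to\mathbb{R}$ exponential if $f(n)=2^{\Theta(n)}$, i.e. if there are constants $a,b>1$ with $a^n\le f(n)\le b^n$ for all sufficiently large $n$. For a finite-dimensional Hilbert space $\mathcal H$ let $\mathcal H^{\odot m}\subseteq\mathcal H^{\otimes m}$ be the symmetric subspace, i.e. the span of the vectors $|\phi\rangle^{\otimes m}$, $\phi\in\mathcal H$; a state on $\mathcal H^{\odot m}$ is a density operator (positive semidefinite, trace one) on $\mathcal H^{\otimes m}$ whose range is contained in $\mathcal H^{\odot m}$. Let $\|A\|_1=\mathrm{tr}\sqrt{A^\dagger A}$ be the trace norm. Theorem. There are an exponential function $m:\mathbb{N}\to\mathbb{N}$ with $m(n)\ge 2$ for all $n$, and an exponential function $q:\mathbb{N}\to\mathbb{R}$, such that for every $n\in\mathbb{N}=\{0,1,2,\dots\}$ and every state $\rho$ on $(\mathbb{C}^{2^n})^{\odot m(n)}$, $$\min_{\sigma\ \mathrm{separable}}\bigl\|\rho|_{\mathcal H_1\otimes\mathcal H_2}-\sigma\bigr\|_1<\frac1{q(n)},$$ where $\rho|_{\mathcal H_1\otimes\mathcal H_2}$ is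 the reduced density operator on the first two tensor factors, the minimum is taken over all separable states $\sigma$ on $\mathbb{C}^{2^n}\otimes\mathbb{C}^{2^n}$ (convex combinations of product states $\sigma_1\otimes\sigma_2$), and this minimum is attained. -/

import Mathlib

open scoped Kronecker ComplexOrder

noncomputable section

/-- A density matrix (quantum state): positive semidefinite of trace one. -/
def IsState {ι : Type*} [Fintype ι] (ρ : Matrix ι ι ℂ) : Prop :=
  ρ.PosSemidef ∧ ρ.trace = 1

/-- The vector `φ ⊗ ⋯ ⊗ φ` (`m` factors) in `(ℂ^d)^{⊗ m}`, the latter being identified, through the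
computational basis, with the functions on multi-indices `Fin m → Fin d`. -/
def tensorPower {d : ℕ} (m : ℕ) (φ : Fin d → ℂ) : (Fin m → Fin d) → ℂ :=
  fun i => ∏ l, φ (i l)

/-- The symmetric subspace `(ℂ^d)^{⊙ m}` of `(ℂ^d)^{⊗ m}`: the span of the vectors `φ^{⊗ m}`. -/
def symmetricSubspace (d m : ℕ) : Submodule ℂ ((Fin m → Fin d) → ℂ) :=
  Submodule.span ℂ (Set.range (tensorPower (d := d) m))

/-- `ρ` is a state on the symmetric subspace: a density matrix on `(ℂ^d)^{⊗ m}` whose range is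
contained in `(ℂ^d)^{⊙ m}`. -/
def IsSymmetricState {d m : ℕ} (ρ : Matrix (Fin m → Fin d) (Fin m → Fin d) ℂ) : Prop :=
  IsState ρ ∧ ∀ v, ρ.mulVec v ∈ symmetricSubspace d m

/-- The multi-index with entry `a` at the first site, `b` at the second, and `c` elsewhere. -/
def joinSites {d m : ℕ} (a b : Fin d) (c : {l : Fin m // 2 ≤ l.val} → Fin d) : Fin m → Fin d :=
  fun l => if h : 2 ≤ l.val then c ⟨l, h⟩ else if l.val = 0 then a else b

/-- The reduced density matrix on the first two sites: the partial trace over all other sites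
(meaningful for `2 ≤ m`). -/
def reducedTwo {d m : ℕ} (ρ : Matrix (Fin m → Fin d) (Fin m → Fin d) ℂ) :
    Matrix (Fin d × Fin d) (Fin d × Fin d) ℂ :=
  Matrix.of fun x y => ∑ c : {l : Fin m // 2 ≤ l.val} → Fin d,
    ρ (joinSites x.1 x.2 c) (joinSites y.1 y.2 c)

/-- The separable states on `ℂ^d ⊗ ℂ^d`: convex combinations of product states. -/
def separableStates (d : ℕ) : Set (Matrix (Fin d × Fin d) (Fin d × Fin d) ℂ) :=
  convexHull ℝ {σ | ∃ A B : Matrix (Fin d) (Fin d) ℂ, IsState A ∧ IsState B ∧ σ = A ⊗ₖ B}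

/-- The trace norm `‖A‖₁ = tr √(A† A)`, that is, the sum of the singular values of `A`. -/
def traceNorm {ι : Type*} [Fintype ι] [DecidableEq ι] (A : Matrix ι ι ℂ) : ℝ :=
  ∑ i, √((Matrix.isHermitian_conjTranspose_mul_self A).eigenvalues i)

/-- `f` is an exponential function of `n`, i.e. `f n = 2 ^ Θ(n)`. -/
def IsExponential (f : ℕ → ℝ) : Prop :=
  ∃ a b : ℝ, 1 < a ∧ 1 < b ∧ ∀ᶠ n in Filter.atTop, a ^ n ≤ f n ∧ f n ≤ b ^ n

end

/-! Put `d = 2 ^ n` and `m = K + 2`. Two sites are kept and the other `K` are measured one after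
another with a fixed informationally complete measurement. The mean over the past outcomes of `∑ y,
P(y | past) ^ 2`, for the next outcome `y`, lies in `[0, 1]`. By exchangeability each further
measurement raises it by at least the mean squared covariances of the next two outcomes given the
past (`sum_sq_covariance_le`). Hence some stage `k < K` has an increment of at most `1 / K`:
conditionally on the past, the two kept sites are then almost uncorrelated
(`exists_sum_abs_covariance_le`).

Forgetting the outcomes does not disturb the kept pair, so its state is the average of its
conditional states; replacing each of these by the product of its marginals gives a separable state.
Matrix units are combinations of measurement operators with coefficients of `ℓ¹` norm at most `8 *
d` (`exists_measurement_span_single`), so every entry of the error is at most `(8 * d) ^ 2 / √K`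
(`exists_separable_entry_le`). Passing from entries to trace norm costs a factor `d ^ 3`, which an
exponential `K` absorbs. The minimum is attained because separable states form a compact set and the
trace norm is continuous. -/

/-! ### Compactness and the trace norm -/

/-- In a finite-dimensional space, the convex hull of a compact set is compact. -/
theorem IsCompact.convexHull_of_finiteDimensional {E : Type*} [NormedAddCommGroup E]
    [NormedSpace ℝ E] [FiniteDimensional ℝ E] {s : Set E} (hs : IsCompact s) :
    IsCompact (convexHull ℝ s) := by
  classical
  rcases s.eq_empty_or_nonempty with rfl | ⟨s₀, hs₀⟩
  · simp
  set N := Module.finrank ℝ E + 1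
  -- By Carathéodory, `N` points always suffice; shorter combinations are padded with weight `0` at
  -- the point `s₀`.
  have himg : convexHull ℝ s = (fun p : (Fin N → ℝ) × (Fin N → E) => ∑ i, p.1 i • p.2 i) ''
      (stdSimplex ℝ (Fin N) ×ˢ Set.univ.pi fun _ => s) := by
    apply Set.Subset.antisymm
    · intro x hx
      obtain ⟨ι, _, z, w, hz, hind, hw, hw1, rfl⟩ := eq_pos_convex_span_of_mem_convexHull hx
      have hcard : Fintype.card ι ≤ Fintype.card (Fin N) := by
        rw [Fintype.card_fin]
        refine hind.card_le_finrank_succ.trans ?_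
        exact Nat.succ_le_succ (Submodule.finrank_le _)
      obtain ⟨e⟩ := Function.Embedding.nonempty_of_card_le hcard
      refine ⟨(Function.extend e w 0, Function.extend e z fun _ => s₀), ⟨⟨?_, ?_⟩, ?_⟩, ?_⟩
      · intro j
        by_cases h : ∃ i, e i = j
        · obtain ⟨i, rfl⟩ := h
          simpa [e.injective.extend_apply] using (hw i).le
        · simp [Function.extend_apply' _ _ _ h]
      · rw [← hw1]
        exact (Fintype.sum_of_injective e e.injective w (Function.extend e w 0)
          (fun j hj => Function.extend_apply' _ _ _ hj)
          fun i => (e.injective.extend_apply _ _ _).symm).symm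
      · intro j _
        by_cases h : ∃ i, e i = j
        · obtain ⟨i, rfl⟩ := h
          simpa [e.injective.extend_apply] using hz ⟨i, rfl⟩
        · simpa [Function.extend_apply' _ _ _ h] using hs₀
      · refine (Fintype.sum_of_injective e e.injective (fun i => w i • z i) _
          (fun j hj => ?_) fun i => ?_).symm
        · have : Function.extend e w 0 j = 0 := Function.extend_apply' _ _ _ hj
          simp [this]
        · simp [e.injective.extend_apply]
    · rintro _ ⟨⟨w, z⟩, ⟨⟨hw, hw1⟩, hz⟩, rfl⟩
      exact (convex_convexHull ℝ s).sum_mem (fun i _ => hw i) hw1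
        fun i _ => subset_convexHull ℝ s (hz i trivial)
  rw [himg]
  refine ((isCompact_stdSimplex ℝ (Fin N)).prod (isCompact_univ_pi fun _ => hs)).image ?_
  fun_prop

open scoped Matrix.Norms.L2Operator MatrixOrder in
theorem Matrix.PosSemidef.exists_eq_conjTranspose_mul_self {ι : Type*} [Fintype ι]
    {A : Matrix ι ι ℂ} (hA : A.PosSemidef) : ∃ B : Matrix ι ι ℂ, A = B.conjTranspose * B := by
  classical
  exact CStarAlgebra.nonneg_iff_eq_star_mul_self.mp hA.nonneg

-- Continuity is inherited from the C⋆-algebraic absolute value, whose trace is the sum of the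
-- singular values; this avoids following individual eigenvalues.
open scoped Matrix.Norms.L2Operator MatrixOrder in
theorem continuous_traceNorm {ι : Type*} [Fintype ι] [DecidableEq ι] :
    Continuous (traceNorm : Matrix ι ι ℂ → ℝ) := by
  have h : (traceNorm : Matrix ι ι ℂ → ℝ) = fun A => (CFC.abs A).trace.re := by
    funext A
    have hA := Matrix.isHermitian_conjTranspose_mul_self A
    rw [CFC.abs, CFC.sqrt_eq_real_sqrt _ (star_mul_self_nonneg A), cfcₙ_eq_cfc,
      Matrix.star_eq_conjTranspose, hA.cfc_eq, Matrix.IsHermitian.cfc,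
      Unitary.conjStarAlgAut_apply, Matrix.trace_mul_cycle]
    simp [traceNorm, Matrix.trace]
  rw [h]
  have := CFC.continuous_abs (A := Matrix ι ι ℂ)
  fun_prop

/-- Cauchy–Schwarz on the singular values, whose squares sum to the squared Frobenius norm. -/
theorem traceNorm_le_sqrt {ι : Type*} [Fintype ι] [DecidableEq ι] (A : Matrix ι ι ℂ) :
    traceNorm A ≤ √(Fintype.card ι * ∑ i, ∑ j, ‖A i j‖ ^ 2) := by
  have hA := Matrix.isHermitian_conjTranspose_mul_self A
  have hpos : (A.conjTranspose * A).PosSemidef := Matrix.posSemidef_conjTranspose_mul_self A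
  have htr : ∑ i, hA.eigenvalues i = ∑ i, ∑ j, ‖A i j‖ ^ 2 := by
    have h := hA.trace_eq_sum_eigenvalues
    have h2 : (A.conjTranspose * A).trace = ((∑ i, ∑ j, ‖A i j‖ ^ 2 : ℝ) : ℂ) := by
      rw [Finset.sum_comm]
      simp [Matrix.trace, Matrix.mul_apply, Complex.conj_mul']
    rw [h2] at h
    have h3 := congrArg Complex.re h
    have h4 : ∀ x y, (((‖A x y‖ : ℝ) : ℂ) ^ 2).re = ‖A x y‖ ^ 2 := fun x y => by
      rw [← Complex.ofReal_pow, Complex.ofReal_re]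
    simpa [h4] using h3.symm
  apply Real.le_sqrt_of_sq_le
  rw [← htr]
  calc traceNorm A ^ 2 ≤ (Finset.univ.card : ℝ) * ∑ i, √(hA.eigenvalues i) ^ 2 :=
        sq_sum_le_card_mul_sum_sq
    _ = _ := by
        simp only [Real.sq_sqrt (hpos.eigenvalues_nonneg _), Finset.card_univ]

theorem traceNorm_sq_le_of_entry_le {ι : Type*} [Fintype ι] [DecidableEq ι] (A : Matrix ι ι ℂ)
    {ε : ℝ} (h : ∀ i j, ‖A i j‖ ^ 2 ≤ ε) :
    traceNorm A ^ 2 ≤ (Fintype.card ι : ℝ) ^ 3 * ε := by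
  have h0 : 0 ≤ traceNorm A := Finset.sum_nonneg fun _ _ => Real.sqrt_nonneg _
  have h1 := pow_le_pow_left₀ h0 (traceNorm_le_sqrt A) 2
  rw [Real.sq_sqrt (by positivity)] at h1
  refine h1.trans ?_
  have h2 : ∑ i, ∑ j, ‖A i j‖ ^ 2 ≤ ∑ _i : ι, ∑ _j : ι, ε :=
    Finset.sum_le_sum fun i _ => Finset.sum_le_sum fun j _ => h i j
  simp only [Finset.sum_const, Finset.card_univ, nsmul_eq_mul] at h2
  calc (Fintype.card ι : ℝ) * ∑ i, ∑ j, ‖A i j‖ ^ 2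
      ≤ Fintype.card ι * (Fintype.card ι * (Fintype.card ι * ε)) := by gcongr
    _ = _ := by ring

/-- States are the image of the Frobenius unit sphere under `B ↦ B† B`. -/
theorem isCompact_setOf_isState {ι : Type*} [Fintype ι] [DecidableEq ι] :
    IsCompact {A : Matrix ι ι ℂ | IsState A} := by
  have hK : IsCompact {B : Matrix ι ι ℂ | (B.conjTranspose * B).trace = 1} := by
    refine IsCompact.of_isClosed_subset (isCompact_univ_pi fun _ => isCompact_univ_pi
      fun _ => isCompact_closedBall (0 : ℂ) 1) (isClosed_eq (by fun_prop) continuous_const) ?_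
    intro B hB i _ j _
    rw [mem_closedBall_zero_iff, ← sq_le_one_iff₀ (norm_nonneg _)]
    have h2 : (B.conjTranspose * B).trace = ((∑ i, ∑ j, ‖B i j‖ ^ 2 : ℝ) : ℂ) := by
      rw [Finset.sum_comm]
      simp [Matrix.trace, Matrix.mul_apply, Complex.conj_mul']
    rw [Set.mem_ofPred_eq, h2] at hB
    have hB' : ∑ i, ∑ j, ‖B i j‖ ^ 2 = 1 := by exact_mod_cast hB
    rw [← hB']
    exact (Finset.single_le_sum (f := fun j => ‖B i j‖ ^ 2) (fun _ _ => by positivity)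
      (Finset.mem_univ j)).trans (Finset.single_le_sum (f := fun i => ∑ j, ‖B i j‖ ^ 2)
        (fun _ _ => by positivity) (Finset.mem_univ i))
  convert hK.image (f := fun B : Matrix ι ι ℂ => B.conjTranspose * B) (by fun_prop) using 1
  ext A
  constructor
  · rintro ⟨hA, htr⟩
    obtain ⟨B, rfl⟩ := hA.exists_eq_conjTranspose_mul_self
    exact ⟨B, htr, rfl⟩
  · rintro ⟨B, hB, rfl⟩
    exact ⟨Matrix.posSemidef_conjTranspose_mul_self B, hB⟩

open scoped Matrix.Norms.L2Operator in
theorem isCompact_separableStates (d : ℕ) : IsCompact (separableStates d) := by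
  apply IsCompact.convexHull_of_finiteDimensional
  have hc : Continuous fun p : Matrix (Fin d) (Fin d) ℂ × Matrix (Fin d) (Fin d) ℂ =>
      p.1 ⊗ₖ p.2 := by
    refine continuous_matrix fun i j => ?_
    simp only [Matrix.kroneckerMap_apply]
    fun_prop
  have hK := (isCompact_setOf_isState.prod isCompact_setOf_isState).image hc
  refine (congrArg IsCompact (Set.Subset.antisymm ?_ ?_)).mpr hK
  · rintro _ ⟨A, B, hA, hB, rfl⟩
    exact ⟨(A, B), ⟨hA, hB⟩, rfl⟩
  · rintro _ ⟨⟨A, B⟩, ⟨hA, hB⟩, rfl⟩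
    exact ⟨A, B, hA, hB, rfl⟩

theorem exists_isLeast_traceNorm_sub {d : ℕ} (ρ : Matrix (Fin d × Fin d) (Fin d × Fin d) ℂ)
    {ε : ℝ} {σ : Matrix (Fin d × Fin d) (Fin d × Fin d) ℂ} (hσ : σ ∈ separableStates d)
    (h : traceNorm (ρ - σ) < ε) :
    ∃ δ : ℝ, IsLeast ((fun σ => traceNorm (ρ - σ)) '' separableStates d) δ ∧ δ < ε := by
  have hcont : Continuous fun σ => traceNorm (ρ - σ) :=
    continuous_traceNorm.comp (continuous_const.sub continuous_id)
  obtain ⟨δ, hδ⟩ := ((isCompact_separableStates d).image hcont).exists_isLeast ⟨_, σ, hσ, rfl⟩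
  exact ⟨δ, hδ, (hδ.2 ⟨σ, hσ, rfl⟩).trans_lt h⟩

/-! ### A classical sequential de Finetti bound -/

/-- For a symmetric (unnormalised) joint distribution `w` of two outcomes, conditioning on the second
one increases the second moments of the first by at least the squared covariances. -/
theorem sum_sq_covariance_le {Y : Type*} [Fintype Y] (w : Y → Y → ℝ)
    (hw : ∀ y z, 0 ≤ w y z) (hsymm : ∀ y z, w y z = w z y) :
    ∑ z, ∑ y, (w y z - (∑ u, w y u) * (∑ u, w z u) / ∑ u, ∑ v, w u v) ^ 2 / (∑ u, ∑ v, w u v) ≤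
      (∑ z, ∑ y, w y z ^ 2 / ∑ u, w z u) - ∑ y, (∑ u, w y u) ^ 2 / (∑ u, ∑ v, w u v) := by
  set r : Y → ℝ := fun y => ∑ u, w y u with hr
  set p : ℝ := ∑ u, r u with hp
  have hr0 : ∀ y, 0 ≤ r y := fun y => Finset.sum_nonneg fun u _ => hw y u
  have hp0 : 0 ≤ p := Finset.sum_nonneg fun u _ => hr0 u
  have hrp : ∀ y, r y ≤ p := fun y =>
    Finset.single_le_sum (f := r) (fun u _ => hr0 u) (Finset.mem_univ y)
  have hwr : ∀ y z, w y z ≤ r z := fun y z => by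
    rw [hsymm]
    exact Finset.single_le_sum (f := w z) (fun u _ => hw z u) (Finset.mem_univ y)
  rcases hp0.eq_or_lt with hp0 | hp0
  · have hr' : ∀ y, r y = 0 := fun y => le_antisymm (hp0 ▸ hrp y) (hr0 y)
    have hw' : ∀ y z, w y z = 0 := fun y z => le_antisymm (hr' z ▸ hwr y z) (hw y z)
    simp [hw']
  have key : ∀ y z, (w y z - r y * r z / p) ^ 2 / p ≤
      w y z ^ 2 / r z - 2 * w y z * r y / p + r y ^ 2 * r z / p ^ 2 := by
    intro y z
    rcases (hr0 z).eq_or_lt with hz | hz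
    · have : w y z = 0 := le_antisymm (hz ▸ hwr y z) (hw y z)
      simp [this, ← hz]
    · calc (w y z - r y * r z / p) ^ 2 / p ≤ (w y z - r y * r z / p) ^ 2 / r z :=
            div_le_div_of_nonneg_left (sq_nonneg _) hz (hrp z)
        _ = _ := by field_simp; ring
  calc ∑ z, ∑ y, (w y z - r y * r z / p) ^ 2 / p
      ≤ ∑ z, ∑ y, (w y z ^ 2 / r z - 2 * w y z * r y / p + r y ^ 2 * r z / p ^ 2) :=
        Finset.sum_le_sum fun z _ => Finset.sum_le_sum fun y _ => key y z
    _ = (∑ z, ∑ y, w y z ^ 2 / r z) - (∑ y, ∑ z, 2 * w y z * r y / p)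
          + ∑ y, ∑ z, r y ^ 2 * r z / p ^ 2 := by
        rw [Finset.sum_comm (f := fun y z => 2 * w y z * r y / p),
          Finset.sum_comm (f := fun y z => r y ^ 2 * r z / p ^ 2)]
        simp only [Finset.sum_add_distrib, Finset.sum_sub_distrib]
    _ = (∑ z, ∑ y, w y z ^ 2 / r z) - ∑ y, r y ^ 2 / p := by
        have h1 : ∀ y, ∑ z, 2 * w y z * r y / p = 2 * (r y ^ 2 / p) := fun y => by
          rw [← Finset.sum_div, ← Finset.sum_mul, ← Finset.mul_sum]
          change 2 * r y * r y / p = _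
          ring
        have h2 : ∀ y, ∑ z, r y ^ 2 * r z / p ^ 2 = r y ^ 2 / p := fun y => by
          rw [← Finset.sum_div, ← Finset.mul_sum, ← hp]
          field_simp
        simp only [h1, h2, ← Finset.mul_sum]
        ring

theorem Fintype.sum_fin_snoc {Y : Type*} [Fintype Y] {M : Type*} [AddCommMonoid M] {k : ℕ}
    (f : (Fin (k + 1) → Y) → M) : ∑ x, f x = ∑ x : Fin k → Y, ∑ z, f (Fin.snoc x z) := by
  rw [← Fintype.sum_prod_type_right' (f := fun z x => f (Fin.snoc x z))]
  exact ((Fin.snocEquiv fun _ => Y).sum_comp f).symm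

/-- A sequential de Finetti bound: `w k x y z` is the probability that the first `k` measurements
give `x` and two further exchangeable measurements give `y` and `z`. At some stage, the two further
measurements are nearly independent conditionally on the past. -/
theorem exists_sum_abs_covariance_le {Y : Type*} [Fintype Y] {K : ℕ} (hK : 0 < K)
    (w : ∀ k, (Fin k → Y) → Y → Y → ℝ) (hw : ∀ k x y z, 0 ≤ w k x y z)
    (hsymm : ∀ k x y z, w k x y z = w k x z y)
    (hstep : ∀ k < K, ∀ x y z, ∑ u, w (k + 1) (Fin.snoc x z) y u = w k x y z)
    (hone : ∀ x, ∑ y, ∑ z, w 0 x y z = 1) :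
    ∃ k < K, ∀ y z, (∑ x, |w k x y z - (∑ u, w k x y u) * (∑ u, w k x z u) /
      ∑ u, ∑ v, w k x u v|) ^ 2 ≤ 1 / K := by
  set p : ∀ k, (Fin k → Y) → ℝ := fun k x => ∑ u, ∑ v, w k x u v with hp
  set r : ∀ k, (Fin k → Y) → Y → ℝ := fun k x y => ∑ u, w k x y u with hr
  set c : ∀ k, (Fin k → Y) → Y → Y → ℝ := fun k x y z =>
    w k x y z - r k x y * r k x z / p k x with hc
  -- The mean conditional collision probability of the next outcome. It stays in `[0, 1]`, so one of
  -- its `K` increments is at most `1 / K`.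
  set Φ : ℕ → ℝ := fun k => ∑ x : Fin k → Y, ∑ y, r k x y ^ 2 / p k x with hΦ
  have hr0 : ∀ k x y, 0 ≤ r k x y := fun k x y => Finset.sum_nonneg fun u _ => hw k x y u
  have hp0 : ∀ k x, 0 ≤ p k x := fun k x => Finset.sum_nonneg fun u _ => hr0 k x u
  have hr1 : ∀ k < K, ∀ x y z, r (k + 1) (Fin.snoc x z) y = w k x y z := hstep
  have hp1 : ∀ k < K, ∀ x z, p (k + 1) (Fin.snoc x z) = r k x z := by
    intro k hk x z
    change ∑ u, r (k + 1) (Fin.snoc x z) u = _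
    simp only [hr]
    exact Finset.sum_congr rfl fun u _ => (hr1 k hk x u z).trans (hsymm k x u z)
  have hpsum : ∀ k ≤ K, ∑ x, p k x = 1 := by
    intro k
    induction k with
    | zero => intro _; simp [hp, hone]
    | succ k ih =>
      intro hk
      rw [Fintype.sum_fin_snoc, ← ih (by omega)]
      refine Finset.sum_congr rfl fun x _ => ?_
      simp only [hp1 k (by omega)]
      rfl
  have hdiff : ∀ k < K, ∑ x, ∑ z, ∑ y, c k x y z ^ 2 / p k x ≤ Φ (k + 1) - Φ k := by
    intro k hk
    have h : Φ (k + 1) = ∑ x : Fin k → Y, ∑ z, ∑ y, w k x y z ^ 2 / r k x z := by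
      simp only [hΦ]
      rw [Fintype.sum_fin_snoc]
      simp only [hr1 k hk, hp1 k hk]
    rw [h, hΦ, ← Finset.sum_sub_distrib]
    exact Finset.sum_le_sum fun x _ => sum_sq_covariance_le (w k x) (hw k x) (hsymm k x)
  have hΦ0 : 0 ≤ Φ 0 := Finset.sum_nonneg fun x _ => Finset.sum_nonneg fun y _ =>
    div_nonneg (sq_nonneg _) (hp0 0 x)
  have hΦK : Φ K ≤ 1 := by
    rw [← hpsum K le_rfl]
    refine Finset.sum_le_sum fun x _ => ?_
    rw [← Finset.sum_div]
    refine div_le_of_le_mul₀ (hp0 K x) (hp0 K x) ?_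
    rw [← sq]
    exact Finset.sum_sq_le_sq_sum_of_nonneg fun y _ => hr0 K x y
  obtain ⟨k, hk, hle⟩ : ∃ k < K, Φ (k + 1) - Φ k ≤ 1 / K := by
    by_contra! h
    have h1 : ∑ k ∈ Finset.range K, (1 / K : ℝ) < ∑ k ∈ Finset.range K, (Φ (k + 1) - Φ k) :=
      Finset.sum_lt_sum_of_nonempty (by simpa using hK.ne') fun k hk => h k (Finset.mem_range.mp hk)
    rw [Finset.sum_range_sub, Finset.sum_const, Finset.card_range, nsmul_eq_mul,
      mul_one_div_cancel (by positivity)] at h1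
    linarith
  refine ⟨k, hk, fun y z => ?_⟩
  have hcp : ∀ x, p k x = 0 → c k x y z = 0 := by
    intro x h
    have h1 : r k x y = 0 := (Finset.sum_eq_zero_iff_of_nonneg fun u _ => hr0 k x u).mp h y
      (Finset.mem_univ y)
    have h2 : w k x y z = 0 := (Finset.sum_eq_zero_iff_of_nonneg fun u _ => hw k x y u).mp h1 z
      (Finset.mem_univ z)
    simp [hc, h1, h2]
  -- Cauchy–Schwarz with the weights `p k x`, which sum to one; where `p k x = 0` the covariance
  -- vanishes too.
  calc (∑ x, |c k x y z|) ^ 2 ≤ (∑ x, p k x) * ∑ x, c k x y z ^ 2 / p k x := by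
        refine Finset.sum_sq_le_sum_mul_sum_of_sq_le_mul _ (fun x _ => hp0 k x)
          (fun x _ => div_nonneg (sq_nonneg _) (hp0 k x)) fun x _ => ?_
        by_cases h : p k x = 0
        · simp [hcp x h, h]
        · rw [sq_abs, mul_div_cancel₀ _ h]
    _ = ∑ x, c k x y z ^ 2 / p k x := by rw [hpsum k hk.le, one_mul]
    _ ≤ ∑ x, ∑ z, ∑ y, c k x y z ^ 2 / p k x := by
        refine Finset.sum_le_sum fun x _ => ?_
        have h0 : ∀ y z, 0 ≤ c k x y z ^ 2 / p k x := fun y z =>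
          div_nonneg (sq_nonneg _) (hp0 k x)
        exact (Finset.single_le_sum (f := fun y => c k x y z ^ 2 / p k x) (fun y _ => h0 y z)
          (Finset.mem_univ y)).trans (Finset.single_le_sum
            (f := fun z => ∑ y, c k x y z ^ 2 / p k x)
            (fun z _ => Finset.sum_nonneg fun y _ => h0 y z) (Finset.mem_univ z))
    _ ≤ 1 / K := (hdiff k hk).trans hle

/-! ### Expectations of product operators -/

/-- The multilinear form `(A₁, …, Aₘ) ↦ tr (ρ (A₁ ⊗ ⋯ ⊗ Aₘ))`. -/
noncomputable def productExpectation {d m : ℕ} (ρ : Matrix (Fin m → Fin d) (Fin m → Fin d) ℂ) :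
    MultilinearMap ℂ (fun _ : Fin m => Matrix (Fin d) (Fin d) ℂ) ℂ :=
  ∑ i, ∑ j, ρ i j • (MultilinearMap.mkPiAlgebra ℂ (Fin m) ℂ).compLinearMap
    fun l => Matrix.entryLinearMap ℂ ℂ (j l) (i l)

section productExpectation
variable {d m : ℕ} {ρ : Matrix (Fin m → Fin d) (Fin m → Fin d) ℂ}

theorem productExpectation_apply (A : Fin m → Matrix (Fin d) (Fin d) ℂ) :
    productExpectation ρ A = ∑ i, ∑ j, ρ i j * ∏ l, A l (j l) (i l) := by
  simp [productExpectation]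

theorem productExpectation_one : productExpectation ρ (fun _ => 1) = ρ.trace := by
  classical
  rw [productExpectation_apply]
  refine Finset.sum_congr rfl fun i _ => ?_
  have h : ∀ j : Fin m → Fin d,
      ∏ l, (1 : Matrix (Fin d) (Fin d) ℂ) (j l) (i l) = if j = i then 1 else 0 := fun j => by
    simp only [Matrix.one_apply, Fintype.prod_ite_zero, Finset.prod_const_one, funext_iff]
  simp [h]

/-- With `A l = (B l)† * B l`, the expectation is a sum of quadratic forms of `ρ` at the conjugated
rows of `⨂ B l`. -/
theorem productExpectation_nonneg (hρ : ρ.PosSemidef) {A : Fin m → Matrix (Fin d) (Fin d) ℂ}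
    (hA : ∀ l, (A l).PosSemidef) : 0 ≤ productExpectation ρ A := by
  choose B hB using fun l => (hA l).exists_eq_conjTranspose_mul_self
  have h : productExpectation ρ A = ∑ κ : Fin m → Fin d,
      star (fun i => ∏ l, star (B l (κ l) (i l))) ⬝ᵥ
        ρ.mulVec (fun i => ∏ l, star (B l (κ l) (i l))) := by
    have h1 : ∀ i j : Fin m → Fin d, ∏ l, A l (j l) (i l) =
        ∑ κ : Fin m → Fin d, (∏ l, star (B l (κ l) (j l))) * ∏ l, B l (κ l) (i l) := fun i j => by
      simp only [hB, Matrix.mul_apply, Matrix.conjTranspose_apply, Finset.prod_univ_sum,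
        Fintype.piFinset_univ, Finset.prod_mul_distrib]
    simp only [productExpectation_apply, h1, Finset.mul_sum, dotProduct, Matrix.mulVec]
    rw [Finset.sum_congr rfl fun i _ => Finset.sum_comm, Finset.sum_comm]
    refine Finset.sum_congr rfl fun κ _ => Finset.sum_congr rfl fun i _ =>
      Finset.sum_congr rfl fun j _ => ?_
    simp only [Pi.star_apply, star_prod, star_star]
    ring
  rw [h]
  exact Finset.sum_nonneg fun κ _ => hρ.dotProduct_mulVec_nonneg _

theorem productExpectation_conjTranspose (hρ : ρ.IsHermitian)
    (A : Fin m → Matrix (Fin d) (Fin d) ℂ) :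
    productExpectation ρ (fun l => (A l).conjTranspose) = star (productExpectation ρ A) := by
  simp only [productExpectation_apply, star_sum, star_mul', star_prod, Matrix.conjTranspose_apply]
  rw [Finset.sum_comm]
  simp only [hρ.apply]

theorem symmetricSubspace_comp_perm (π : Equiv.Perm (Fin m)) {u : (Fin m → Fin d) → ℂ}
    (hu : u ∈ symmetricSubspace d m) (i : Fin m → Fin d) : u (i ∘ π) = u i := by
  induction hu using Submodule.span_induction with
  | mem x hx =>
    obtain ⟨φ, rfl⟩ := hx
    exact Equiv.prod_comp π fun l => φ (i l)
  | zero => rfl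
  | add x y _ _ hx hy => simp [hx, hy]
  | smul a x _ hx => simp [hx]

/-- The columns of `ρ` are symmetric tensors, so permuting the row index alone changes nothing;
hermiticity transfers this to the column index. -/
theorem IsSymmetricState.apply_comp_perm (hρ : IsSymmetricState ρ) (π : Equiv.Perm (Fin m))
    (i j : Fin m → Fin d) : ρ (i ∘ π) (j ∘ π) = ρ i j := by
  classical
  have h : ∀ i j : Fin m → Fin d, ρ (i ∘ π) j = ρ i j := fun i j => by
    have := symmetricSubspace_comp_perm π (hρ.2 (Pi.single j 1)) i
    simpa using this
  rw [h, ← hρ.1.1.isHermitian.apply, h, hρ.1.1.isHermitian.apply]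

theorem productExpectation_comp_perm (hρ : IsSymmetricState ρ) (π : Equiv.Perm (Fin m))
    (A : Fin m → Matrix (Fin d) (Fin d) ℂ) :
    productExpectation ρ (A ∘ π) = productExpectation ρ A := by
  simp only [productExpectation_apply]
  rw [← (π.symm.arrowCongr (Equiv.refl (Fin d))).sum_comp]
  refine Finset.sum_congr rfl fun i _ => ?_
  rw [← (π.symm.arrowCongr (Equiv.refl (Fin d))).sum_comp]
  refine Finset.sum_congr rfl fun j _ => ?_
  rw [← hρ.apply_comp_perm π i j]
  congr 1
  · rw [← Equiv.prod_comp π fun l => A l _ _]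
    simp
end productExpectation

/-! ### Two kept sites and `K` further sites -/

section pairForm
variable {d K : ℕ} {ρ : Matrix (Fin (K + 2) → Fin d) (Fin (K + 2) → Fin d) ℂ}

/-- The bilinear form `(A, B) ↦ tr (ρ (A ⊗ B ⊗ T₁ ⊗ ⋯ ⊗ T_K))`. -/
noncomputable def pairForm (ρ : Matrix (Fin (K + 2) → Fin d) (Fin (K + 2) → Fin d) ℂ)
    (T : Fin K → Matrix (Fin d) (Fin d) ℂ) :
    Matrix (Fin d) (Fin d) ℂ →ₗ[ℂ] Matrix (Fin d) (Fin d) ℂ →ₗ[ℂ] ℂ :=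
  LinearMap.mk₂ ℂ (fun A B => productExpectation ρ (Fin.cons A (Fin.cons B T)))
    (fun A A' _ => (productExpectation ρ).cons_add _ A A')
    (fun c A _ => (productExpectation ρ).cons_smul _ c A)
    (fun A B B' => ((productExpectation ρ).curryLeft A).cons_add T B B')
    (fun c A B => ((productExpectation ρ).curryLeft A).cons_smul T c B)

theorem pairForm_apply (T : Fin K → Matrix (Fin d) (Fin d) ℂ) (A B : Matrix (Fin d) (Fin d) ℂ) :
    pairForm ρ T A B = productExpectation ρ (Fin.cons A (Fin.cons B T)) := rfl

theorem forall_cons_cons {α : Type*} {P : α → Prop} {A B : α} {T : Fin K → α} (hA : P A) (hB : P B)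
    (hT : ∀ l, P (T l)) (l : Fin (K + 2)) :
    P ((Fin.cons A (Fin.cons B T : Fin (K + 1) → α) : Fin (K + 2) → α) l) := by
  refine Fin.cases ?_ (fun l => Fin.cases ?_ (fun l => ?_) l) l
  · simpa
  · simpa
  · simpa using hT l

theorem pairForm_nonneg (hρ : ρ.PosSemidef) {T : Fin K → Matrix (Fin d) (Fin d) ℂ}
    (hT : ∀ l, (T l).PosSemidef) {A B : Matrix (Fin d) (Fin d) ℂ} (hA : A.PosSemidef)
    (hB : B.PosSemidef) : 0 ≤ pairForm ρ T A B :=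
  productExpectation_nonneg hρ (forall_cons_cons hA hB hT)

theorem pairForm_conjTranspose (hρ : ρ.IsHermitian) {T : Fin K → Matrix (Fin d) (Fin d) ℂ}
    (hT : ∀ l, (T l).IsHermitian) (A B : Matrix (Fin d) (Fin d) ℂ) :
    pairForm ρ T A.conjTranspose B.conjTranspose = star (pairForm ρ T A B) := by
  rw [pairForm_apply, pairForm_apply, ← productExpectation_conjTranspose hρ]
  congr 1
  funext l
  refine Fin.cases ?_ (fun l => Fin.cases ?_ (fun l => ?_) l) l
  · simp
  · simp
  · simpa using (hT l).symm

theorem pairForm_comm (hρ : IsSymmetricState ρ) (T : Fin K → Matrix (Fin d) (Fin d) ℂ)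
    (A B : Matrix (Fin d) (Fin d) ℂ) : pairForm ρ T A B = pairForm ρ T B A := by
  rw [pairForm_apply, ← productExpectation_comp_perm hρ (Equiv.swap 0 1), pairForm_apply]
  congr 1
  funext l
  refine Fin.cases ?_ (fun l => Fin.cases ?_ (fun l => ?_) l) l
  · simp
  · simp
  · have h0 : l.succ.succ ≠ 0 := Fin.succ_ne_zero _
    have h1 : l.succ.succ ≠ 1 := by
      rw [← Fin.succ_zero_eq_one]; exact fun h => Fin.succ_ne_zero _ (Fin.succ_injective _ h)
    simp [Equiv.swap_apply_of_ne_of_ne h0 h1]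

/-- Transposing the second kept site with the `k`-th further one. When `T k = 1`, an outcome at the
kept site becomes one more past outcome. -/
theorem pairForm_update (hρ : IsSymmetricState ρ) (T : Fin K → Matrix (Fin d) (Fin d) ℂ)
    (k : Fin K) (A B : Matrix (Fin d) (Fin d) ℂ) :
    pairForm ρ (Function.update T k B) A (T k) = pairForm ρ T A B := by
  rw [pairForm_apply, ← productExpectation_comp_perm hρ (Equiv.swap 1 k.succ.succ), pairForm_apply]
  congr 1
  funext l
  refine Fin.cases ?_ (fun l => Fin.cases ?_ (fun l => ?_) l) l
  · have h1 : (0 : Fin (K + 2)) ≠ k.succ.succ := (Fin.succ_ne_zero _).symm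
    simp [Equiv.swap_apply_of_ne_of_ne zero_ne_one h1, Function.update_of_ne h1]
  · simp
  · rcases eq_or_ne l k with rfl | h
    · have h1 : (1 : Fin (K + 2)) ≠ l.succ.succ := by
        rw [← Fin.succ_zero_eq_one]; exact fun h => Fin.succ_ne_zero _ (Fin.succ_injective _ h).symm
      simp [Function.update_of_ne h1]
    · have h1 : l.succ.succ ≠ 1 := by
        rw [← Fin.succ_zero_eq_one]; exact fun h => Fin.succ_ne_zero _ (Fin.succ_injective _ h)
      have h2 : l.succ.succ ≠ k.succ.succ := by simpa using h
      simp [Equiv.swap_apply_of_ne_of_ne h1 h2, h]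

theorem sum_pairForm_update {Y : Type*} [Fintype Y] (T : Fin K → Matrix (Fin d) (Fin d) ℂ)
    (k : Fin K) (M : Y → Matrix (Fin d) (Fin d) ℂ) (A B : Matrix (Fin d) (Fin d) ℂ) :
    ∑ z, pairForm ρ (Function.update T k (M z)) A B =
      pairForm ρ (Function.update T k (∑ z, M z)) A B := by
  simp only [pairForm_apply, Fin.cons_update]
  rw [MultilinearMap.map_update_sum]

/-- Multi-indices split into their first two entries and the remaining ones. -/
def joinSitesEquiv (d K : ℕ) :
    (Fin d × Fin d) × ({l : Fin (K + 2) // 2 ≤ l.val} → Fin d) ≃ (Fin (K + 2) → Fin d) where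
  toFun p := joinSites p.1.1 p.1.2 p.2
  invFun i := ((i 0, i 1), fun l => i l.1)
  left_inv p := by
    refine Prod.ext (Prod.ext ?_ ?_) ?_
    · simp [joinSites]
    · simp [joinSites]
    · funext l
      simp [joinSites, l.2]
  right_inv i := by
    funext l
    dsimp only [joinSites]
    split_ifs with h h'
    · rfl
    · exact congrArg i (Fin.ext h'.symm)
    · refine congrArg i (Fin.ext ?_)
      have : ((1 : Fin (K + 2)) : ℕ) = 1 := rfl
      omega

theorem prod_joinSites (A B : Matrix (Fin d) (Fin d) ℂ) (a b a' b' : Fin d)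
    (c c' : {l : Fin (K + 2) // 2 ≤ l.val} → Fin d) :
    ∏ l, (Fin.cons A (Fin.cons B fun _ => 1) : Fin (K + 2) → Matrix (Fin d) (Fin d) ℂ) l
      (joinSites a' b' c' l) (joinSites a b c l) =
    A a' a * (B b' b * if c = c' then 1 else 0) := by
  have h : ∀ (a b : Fin d) (c : {l : Fin (K + 2) // 2 ≤ l.val} → Fin d) (l : Fin K),
      joinSites a b c l.succ.succ = c ⟨l.succ.succ, by simp⟩ := fun a b c l => by
    simp [joinSites]
  have h0 : ∀ (a b : Fin d) (c : {l : Fin (K + 2) // 2 ≤ l.val} → Fin d),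
      joinSites a b c 0 = a := fun a b c => by simp [joinSites]
  have h1 : ∀ (a b : Fin d) (c : {l : Fin (K + 2) // 2 ≤ l.val} → Fin d),
      joinSites a b c (Fin.succ 0) = b := fun a b c => by simp [joinSites]
  rw [Fin.prod_univ_succ, Fin.prod_univ_succ]
  simp only [h, h0, h1, Fin.cons_zero, Fin.cons_succ, Matrix.one_apply, Fintype.prod_ite_zero,
    Finset.prod_const_one]
  congr 3
  refine propext ⟨fun hc => funext fun l => ?_, fun hc l => by rw [hc]⟩
  obtain ⟨l, hl⟩ := l
  obtain ⟨j, rfl⟩ := Fin.exists_succ_eq.mpr (show l ≠ 0 by rintro rfl; simp at hl)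
  obtain ⟨j, rfl⟩ := Fin.exists_succ_eq.mpr (show j ≠ 0 by rintro rfl; simp at hl)
  exact (hc j).symm

/-- Matrix units appear transposed because `tr (ρ E_{yx})` is the entry `ρ_{xy}`. -/
theorem reducedTwo_apply (x y : Fin d × Fin d) :
    reducedTwo ρ x y =
      pairForm ρ (fun _ => 1) (Matrix.single y.1 x.1 1) (Matrix.single y.2 x.2 1) := by
  rw [pairForm_apply, productExpectation_apply, ← (joinSitesEquiv d K).sum_comp]
  calc reducedTwo ρ x y
      = ∑ p : (Fin d × Fin d) × ({l : Fin (K + 2) // 2 ≤ l.val} → Fin d),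
          ∑ q : (Fin d × Fin d) × ({l : Fin (K + 2) // 2 ≤ l.val} → Fin d),
            ρ (joinSites p.1.1 p.1.2 p.2) (joinSites q.1.1 q.1.2 q.2) *
              (Matrix.single y.1 x.1 1 q.1.1 p.1.1 *
                (Matrix.single y.2 x.2 1 q.1.2 p.1.2 * if p.2 = q.2 then 1 else 0)) := by
        simp [Fintype.sum_prod_type, Matrix.single_apply, ite_and, reducedTwo]
    _ = _ := by
        refine Finset.sum_congr rfl fun p _ => ?_
        rw [← (joinSitesEquiv d K).sum_comp]
        refine Finset.sum_congr rfl fun q _ => ?_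
        rw [← prod_joinSites]
        rfl

end pairForm

/-! ### The measurement -/

/-- An informationally complete measurement with well-conditioned dual frame. -/
theorem exists_measurement_span_single (d : ℕ) [NeZero d] :
    ∃ M : Fin d × Fin d × Fin 4 → Matrix (Fin d) (Fin d) ℂ, (∀ y, (M y).PosSemidef) ∧
      ∑ y, M y = 1 ∧ ∀ a b, ∃ c : Fin d × Fin d × Fin 4 → ℂ,
        Matrix.single a b 1 = ∑ y, c y • M y ∧ ∑ y, ‖c y‖ ≤ 8 * d := by
  have hd : (d : ℂ) ≠ 0 := Nat.cast_ne_zero.mpr (NeZero.ne d)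
  -- Polarization: for `v = e_a + i ^ s e_b`, weighting `v v†` by `i ^ s` and summing over `s`
  -- leaves `4 E_{ab}`. The unweighted sum over all `a, b, s` is `8 d` times the identity, whence
  -- the normalisation.
  set v : Fin d × Fin d × Fin 4 → Fin d → ℂ := fun y =>
    Pi.single y.1 1 + Complex.I ^ (y.2.2 : ℕ) • Pi.single y.2.1 1 with hv
  have hV : ∀ a b s, Matrix.vecMulVec (v (a, b, s)) (star (v (a, b, s))) =
      Matrix.single a a 1 + Matrix.single b b 1
        + star (Complex.I ^ (s : ℕ)) • Matrix.single a b (1 : ℂ)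
        + Complex.I ^ (s : ℕ) • Matrix.single b a 1 := by
    intro a b s
    have hs : star (Complex.I ^ (s : ℕ)) * Complex.I ^ (s : ℕ) = 1 := by
      rw [star_pow, ← mul_pow]; simp
    have h1 : star (v (a, b, s)) =
        Pi.single a 1 + star (Complex.I ^ (s : ℕ)) • Pi.single b 1 := by
      simp only [hv, star_add, star_smul, ← Pi.single_star, star_one]
    rw [h1]
    simp only [hv, Matrix.add_vecMulVec, Matrix.vecMulVec_add, Matrix.smul_vecMulVec,
      Matrix.vecMulVec_smul, ← Matrix.single_eq_single_vecMulVec_single, smul_add, smul_smul, hs,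
      one_smul]
    abel
  have hI3 : Complex.I ^ 3 = -Complex.I := Complex.I_pow_three
  refine ⟨fun y => (8 * d : ℂ)⁻¹ • Matrix.vecMulVec (v y) (star (v y)), fun y => ?_, ?_,
    fun a b => ?_⟩
  · exact (Matrix.posSemidef_vecMulVec_self_star _).smul (by positivity)
  · have h : ∀ a b, ∑ s, Matrix.vecMulVec (v (a, b, s)) (star (v (a, b, s))) =
        (4 : ℂ) • (Matrix.single a a 1 + Matrix.single b b 1) := by
      intro a b
      simp only [hV, Fin.sum_univ_four]
      simp [hI3, -Matrix.smul_single]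
      module
    have h1 : ∑ a : Fin d, Matrix.single a a (1 : ℂ) = 1 := by
      ext i j
      simp [Matrix.sum_apply, Matrix.single_apply, Matrix.one_apply, ite_and]
    rw [← Finset.smul_sum]
    simp only [Fintype.sum_prod_type, h, ← Finset.smul_sum, Finset.sum_add_distrib, h1,
      Finset.sum_const, Finset.card_univ, Fintype.card_fin]
    rw [← Nat.cast_smul_eq_nsmul ℂ]
    simp only [smul_smul, ← add_smul]
    convert one_smul ℂ (1 : Matrix (Fin d) (Fin d) ℂ) using 2
    field_simp
    ring
  · refine ⟨fun y => if y.1 = a ∧ y.2.1 = b then 2 * d * Complex.I ^ (y.2.2 : ℕ) else 0, ?_, ?_⟩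
    · have h : ∑ s : Fin 4, (Complex.I ^ (s : ℕ)) •
          Matrix.vecMulVec (v (a, b, s)) (star (v (a, b, s))) =
          (4 : ℂ) • Matrix.single a b 1 := by
        simp only [hV, Fin.sum_univ_four]
        simp [hI3, -Matrix.smul_single, smul_add, smul_smul, Complex.I_mul_I]
        module
      rw [Fintype.sum_prod_type, Finset.sum_eq_single a
        (fun a' _ ha => Finset.sum_eq_zero fun z _ => by simp [ha]) (by simp),
        Fintype.sum_prod_type, Finset.sum_eq_single b
        (fun b' _ hb => Finset.sum_eq_zero fun z _ => by simp [hb]) (by simp)]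
      calc Matrix.single a b (1 : ℂ) = (4⁻¹ : ℂ) • (4 : ℂ) • Matrix.single a b 1 := by
            rw [smul_smul, inv_mul_cancel₀ (by norm_num), one_smul]
        _ = _ := by
            rw [← h, Finset.smul_sum]
            refine Finset.sum_congr rfl fun s _ => ?_
            dsimp only
            rw [if_pos ⟨rfl, rfl⟩, smul_smul, smul_smul]
            congr 1
            field_simp
            norm_num
    · simp [Fintype.sum_prod_type, ite_and, apply_ite norm]
      rw [Finset.sum_comm]
      simp
      linarith

/-! ### From measurement outcomes to a separable state -/

section deFinetti
variable {d K : ℕ} {ρ : Matrix (Fin (K + 2) → Fin d) (Fin (K + 2) → Fin d) ℂ} {Y : Type*}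

/-- The first `k` sites carry the operators `M (x 0), …, M (x (k - 1))`, the others the identity. -/
def measuredSites (K : ℕ) (M : Y → Matrix (Fin d) (Fin d) ℂ) {k : ℕ} (x : Fin k → Y) :
    Fin K → Matrix (Fin d) (Fin d) ℂ :=
  fun l => if h : l.val < k then M (x ⟨l, h⟩) else 1

theorem measuredSites_posSemidef {M : Y → Matrix (Fin d) (Fin d) ℂ} (hM : ∀ y, (M y).PosSemidef)
    {k : ℕ} (x : Fin k → Y) (l : Fin K) : (measuredSites K M x l).PosSemidef := by
  unfold measuredSites
  split_ifs
  · exact hM _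
  · exact Matrix.PosSemidef.one

theorem measuredSites_zero (M : Y → Matrix (Fin d) (Fin d) ℂ) (x : Fin 0 → Y) :
    measuredSites K M x = fun _ => 1 := by
  funext l
  simp [measuredSites]

theorem measuredSites_self (M : Y → Matrix (Fin d) (Fin d) ℂ) {k : ℕ} (hk : k < K)
    (x : Fin k → Y) : measuredSites K M x ⟨k, hk⟩ = 1 := by
  simp [measuredSites]

theorem measuredSites_snoc (M : Y → Matrix (Fin d) (Fin d) ℂ) {k : ℕ} (hk : k < K)
    (x : Fin k → Y) (z : Y) :
    measuredSites K M (Fin.snoc x z : Fin (k + 1) → Y) =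
      Function.update (measuredSites K M x) ⟨k, hk⟩ (M z) := by
  funext l
  rcases lt_trichotomy l.val k with h | h | h
  · have hl : l ≠ ⟨k, hk⟩ := fun e => h.ne (congrArg Fin.val e)
    simp [measuredSites, hl, h, h.trans (Nat.lt_succ_self k), Fin.snoc]
  · obtain rfl : l = ⟨k, hk⟩ := Fin.ext h
    simp [measuredSites, Fin.snoc]
  · have hl : l ≠ ⟨k, hk⟩ := fun e => h.ne' (congrArg Fin.val e)
    have h1 : ¬ l.val < k + 1 := by omega
    have h2 : ¬ l.val < k := by omega
    simp [measuredSites, hl, h1, h2]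

variable [Fintype Y]

/-- Measuring a site and forgetting the outcome inserts `∑ y, M y = 1` there. -/
theorem sum_pairForm_measuredSites {M : Y → Matrix (Fin d) (Fin d) ℂ} (hM : ∑ y, M y = 1)
    {k : ℕ} (hk : k ≤ K) (A B : Matrix (Fin d) (Fin d) ℂ) :
    ∑ x : Fin k → Y, pairForm ρ (measuredSites K M x) A B = pairForm ρ (fun _ => 1) A B := by
  induction k with
  | zero => simp [measuredSites_zero]
  | succ k ih =>
    rw [Fintype.sum_fin_snoc, ← ih (by omega)]
    refine Finset.sum_congr rfl fun x _ => ?_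
    simp only [measuredSites_snoc M (show k < K from hk), sum_pairForm_update, hM]
    rw [← measuredSites_self M hk x, Function.update_eq_self]

/-- The unnormalised reduced state of the first site given operators `T` on the sites `≥ 2`. -/
noncomputable def siteMatrix (ρ : Matrix (Fin (K + 2) → Fin d) (Fin (K + 2) → Fin d) ℂ)
    (T : Fin K → Matrix (Fin d) (Fin d) ℂ) : Matrix (Fin d) (Fin d) ℂ :=
  Matrix.of fun a b => pairForm ρ T (Matrix.single b a 1) 1

/-- Its quadratic form at `v` is the expectation of the positive operator `v v†`. -/
theorem siteMatrix_posSemidef (hρ : ρ.PosSemidef) {T : Fin K → Matrix (Fin d) (Fin d) ℂ}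
    (hT : ∀ l, (T l).PosSemidef) : (siteMatrix ρ T).PosSemidef := by
  refine Matrix.PosSemidef.of_dotProduct_mulVec_nonneg ?_ fun v => ?_
  · ext a b
    rw [Matrix.conjTranspose_apply, siteMatrix, Matrix.of_apply, Matrix.of_apply,
      ← pairForm_conjTranspose hρ.isHermitian fun l => (hT l).isHermitian]
    simp
  · have h : star v ⬝ᵥ (siteMatrix ρ T).mulVec v =
        pairForm ρ T (Matrix.vecMulVec v (star v)) 1 := by
      conv_rhs => rw [Matrix.matrix_eq_sum_single (Matrix.vecMulVec v (star v))]
      have h1 : ∀ a b, Matrix.single a b (Matrix.vecMulVec v (star v) a b) =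
          (v a * star (v b)) • Matrix.single a b (1 : ℂ) := fun a b => by
        simp [Matrix.vecMulVec_apply]
      simp only [h1, map_sum, map_smul, LinearMap.sum_apply, LinearMap.smul_apply, dotProduct,
        Matrix.mulVec, Finset.mul_sum, siteMatrix, Matrix.of_apply, Pi.star_apply, smul_eq_mul]
      rw [Finset.sum_comm]
      refine Finset.sum_congr rfl fun a _ => Finset.sum_congr rfl fun b _ => ?_
      ring
    rw [h]
    exact pairForm_nonneg hρ hT (Matrix.posSemidef_vecMulVec_self_star v) Matrix.PosSemidef.one

theorem siteMatrix_trace (T : Fin K → Matrix (Fin d) (Fin d) ℂ) :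
    (siteMatrix ρ T).trace = pairForm ρ T 1 1 := by
  have h1 : ∑ a : Fin d, Matrix.single a a (1 : ℂ) = 1 := by
    ext i j
    simp [Matrix.sum_apply, Matrix.single_apply, Matrix.one_apply, ite_and]
  calc (siteMatrix ρ T).trace = (pairForm ρ T).flip 1 (∑ a, Matrix.single a a 1) := by
        simp [siteMatrix, Matrix.trace]
    _ = pairForm ρ T 1 1 := by rw [h1, LinearMap.flip_apply]

theorem IsState.smul_of_trace {ι : Type*} [Fintype ι] {A : Matrix ι ι ℂ} (hA : A.PosSemidef)
    {p : ℝ} (hp : 0 < p) (htr : A.trace = p) : IsState ((p⁻¹ : ℝ) • A) := by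
  refine ⟨hA.smul (by positivity), ?_⟩
  rw [Matrix.trace_smul, htr, Complex.real_smul, ← Complex.ofReal_mul, inv_mul_cancel₀ hp.ne']
  simp

theorem exists_separable_entry_le [NeZero d] (hK : 0 < K) (hρ : IsSymmetricState ρ) :
    ∃ σ ∈ separableStates d, ∀ x y, ‖(reducedTwo ρ - σ) x y‖ ^ 2 ≤ (8 * d : ℝ) ^ 4 / K := by
  obtain ⟨M, hM, hM1, hspan⟩ := exists_measurement_span_single d
  set T : ∀ k, (Fin k → Fin d × Fin d × Fin 4) → Fin K → Matrix (Fin d) (Fin d) ℂ :=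
    fun k x => measuredSites K M x with hTdef
  have hT : ∀ k x l, (T k x l).PosSemidef := fun k x l => measuredSites_posSemidef hM x l
  set w : ∀ k, (Fin k → Fin d × Fin d × Fin 4) → _ → _ → ℝ :=
    fun k x y z => (pairForm ρ (T k x) (M y) (M z)).re with hw
  have hnn : ∀ k x y z, 0 ≤ pairForm ρ (T k x) (M y) (M z) := fun k x y z =>
    pairForm_nonneg hρ.1.1 (hT k x) (hM y) (hM z)
  have hBw : ∀ k x y z, pairForm ρ (T k x) (M y) (M z) = (w k x y z : ℂ) := fun k x y z =>
    Complex.eq_re_of_ofReal_le (r := 0) (by simpa using hnn k x y z)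
  have hB1 : ∀ k x y, pairForm ρ (T k x) (M y) 1 = ((∑ u, w k x y u : ℝ) : ℂ) := fun k x y => by
    rw [← hM1, map_sum, Complex.ofReal_sum]
    exact Finset.sum_congr rfl fun u _ => hBw k x y u
  have hB11 : ∀ k x, pairForm ρ (T k x) 1 1 = ((∑ y, ∑ u, w k x y u : ℝ) : ℂ) := fun k x => by
    rw [Complex.ofReal_sum]
    rw [← LinearMap.flip_apply, ← Finset.sum_congr rfl fun y _ => hB1 k x y]
    simp only [← LinearMap.flip_apply (pairForm ρ (T k x)) _ (1 : Matrix (Fin d) (Fin d) ℂ)]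
    rw [← map_sum, hM1]
  have htr : pairForm ρ (fun _ => 1) 1 1 = 1 := by
    have h : (Fin.cons 1 (Fin.cons 1 fun _ => 1) : Fin (K + 2) → Matrix (Fin d) (Fin d) ℂ) =
        fun _ => 1 :=
      funext (forall_cons_cons (P := fun A => A = 1) rfl rfl fun _ => rfl)
    rw [pairForm_apply, h, productExpectation_one, hρ.1.2]
  obtain ⟨k, hk, hcov⟩ := exists_sum_abs_covariance_le hK w
    (fun k x y z => (Complex.nonneg_iff.mp (hnn k x y z)).1)
    (fun k x y z => congrArg Complex.re (pairForm_comm hρ _ _ _))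
    (fun k hk x y z => by
      apply Complex.ofReal_injective
      rw [← hB1, ← hBw, ← pairForm_update hρ (T k x) ⟨k, hk⟩ (M y) (M z)]
      simp only [hTdef, measuredSites_snoc M hk, measuredSites_self])
    (fun x => by
      apply Complex.ofReal_injective
      rw [← hB11, hTdef]
      simp [measuredSites_zero, htr])
  set p : (Fin k → Fin d × Fin d × Fin 4) → ℝ := fun x => ∑ y, ∑ u, w k x y u with hp
  have hp0 : ∀ x, 0 ≤ p x := fun x => Finset.sum_nonneg fun y _ => Finset.sum_nonneg fun u _ =>
    (Complex.nonneg_iff.mp (hnn k x y u)).1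
  have hpsum : ∑ x, p x = 1 := by
    apply Complex.ofReal_injective
    rw [Complex.ofReal_sum, Complex.ofReal_one, ← htr, ← sum_pairForm_measuredSites hM1 hk.le]
    exact Finset.sum_congr rfl fun x _ => (hB11 k x).symm
  set R := fun x => siteMatrix ρ (T k x) with hR
  -- The average of products of conditional one-site states. Both factors agree by symmetry;
  -- outcomes of probability zero have no normalised state and are dropped.
  refine ⟨∑ x with p x ≠ 0, p x • (((p x)⁻¹ • R x) ⊗ₖ ((p x)⁻¹ • R x)), ?_, fun i j => ?_⟩
  · refine (convex_convexHull ℝ _).sum_mem (fun x _ => hp0 x) ?_ fun x hx => ?_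
    · rw [Finset.sum_filter_ne_zero, hpsum]
    · have hpx : 0 < p x := (hp0 x).lt_of_ne' (Finset.mem_filter.mp hx).2
      have hs : IsState ((p x)⁻¹ • R x) :=
        IsState.smul_of_trace (siteMatrix_posSemidef hρ.1.1 (hT k x)) hpx
          ((siteMatrix_trace _).trans (hB11 k x))
      exact subset_convexHull ℝ _ ⟨_, _, hs, hs, rfl⟩
  set C : (Fin k → Fin d × Fin d × Fin 4) → Matrix (Fin d) (Fin d) ℂ → Matrix (Fin d) (Fin d) ℂ → ℂ :=
    fun x A B => pairForm ρ (T k x) A B -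
      pairForm ρ (T k x) A 1 * pairForm ρ (T k x) B 1 / p x with hC
  have hentry : (reducedTwo ρ - ∑ x with p x ≠ 0, p x • (((p x)⁻¹ • R x) ⊗ₖ ((p x)⁻¹ • R x))) i j =
      ∑ x, C x (Matrix.single j.1 i.1 1) (Matrix.single j.2 i.2 1) := by
    rw [Matrix.sub_apply, reducedTwo_apply, ← sum_pairForm_measuredSites hM1 hk.le,
      Finset.sum_sub_distrib, Matrix.sum_apply, Finset.sum_filter]
    congr 1
    refine Finset.sum_congr rfl fun x _ => ?_
    by_cases hpx : p x = 0
    · simp [hpx]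
    · have : (p x : ℂ) ≠ 0 := by exact_mod_cast hpx
      simp only [ne_eq, hpx, not_false_eq_true, if_true, Matrix.smul_apply,
        Matrix.kroneckerMap_apply, Complex.real_smul, hR, siteMatrix, Matrix.of_apply,
        Complex.ofReal_inv]
      field_simp
  -- `C x` is bilinear, so the covariance bound on measurement operators extends to matrix units at
  -- the cost of the two `ℓ¹` norms.
  obtain ⟨c, hc, hcn⟩ := hspan j.1 i.1
  obtain ⟨c', hc', hcn'⟩ := hspan j.2 i.2
  set η : ℝ := √(1 / K) with hη
  have hcov' : ∀ y z, ‖∑ x, C x (M y) (M z)‖ ≤ η := fun y z => by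
    refine (norm_sum_le _ _).trans (le_of_eq_of_le ?_ (Real.le_sqrt_of_sq_le (hcov y z)))
    refine Finset.sum_congr rfl fun x _ => ?_
    simp only [hC, hBw, hB1]
    rw [← Complex.ofReal_mul, ← Complex.ofReal_div, ← Complex.ofReal_sub, Complex.norm_real,
      Real.norm_eq_abs]
  have hexp : ∑ x, C x (Matrix.single j.1 i.1 1) (Matrix.single j.2 i.2 1) =
      ∑ y, ∑ z, c y * c' z * ∑ x, C x (M y) (M z) := by
    have h : ∀ x, C x (Matrix.single j.1 i.1 1) (Matrix.single j.2 i.2 1) =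
        ∑ y, ∑ z, c y * c' z * C x (M y) (M z) := fun x => by
      simp only [hC, hc, hc', map_sum, map_smul, LinearMap.sum_apply, LinearMap.smul_apply,
        smul_eq_mul, Finset.sum_mul, Finset.sum_div, mul_sub, Finset.sum_sub_distrib,
        Finset.mul_sum]
      congr 1
      all_goals
        rw [Finset.sum_comm]
        refine Finset.sum_congr rfl fun y _ => Finset.sum_congr rfl fun z _ => ?_
        ring
    simp only [h, Finset.mul_sum]
    rw [Finset.sum_comm]
    exact Finset.sum_congr rfl fun y _ => Finset.sum_comm
  have hbound : ‖∑ x, C x (Matrix.single j.1 i.1 1) (Matrix.single j.2 i.2 1)‖ ≤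
      (8 * d) * (8 * d) * η := by
    rw [hexp]
    calc ‖∑ y, ∑ z, c y * c' z * ∑ x, C x (M y) (M z)‖
        ≤ ∑ y, ∑ z, ‖c y‖ * ‖c' z‖ * η := by
          refine (norm_sum_le _ _).trans (Finset.sum_le_sum fun y _ =>
            (norm_sum_le _ _).trans (Finset.sum_le_sum fun z _ => ?_))
          rw [norm_mul, norm_mul]
          exact mul_le_mul_of_nonneg_left (hcov' y z) (by positivity)
      _ = (∑ y, ‖c y‖) * (∑ z, ‖c' z‖) * η := by
          rw [Finset.sum_mul_sum, Finset.sum_mul]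
          simp only [Finset.sum_mul]
      _ ≤ (8 * d) * (8 * d) * η := by gcongr
  rw [hentry]
  calc _ ≤ ((8 * d) * (8 * d) * η) ^ 2 := by gcongr
    _ = (8 * d : ℝ) ^ 4 / K := by
      rw [mul_pow, hη, Real.sq_sqrt (by positivity)]
      ring
end deFinetti

/-! ### Choice of parameters -/

theorem isExponential_two_pow : IsExponential fun n => 2 ^ n :=
  ⟨2, 2, one_lt_two, one_lt_two, Filter.Eventually.of_forall fun _ => ⟨le_rfl, le_rfl⟩⟩

theorem isExponential_numberOfSites :
    IsExponential fun n => ((16384 * (2 ^ n) ^ 12 + 2 : ℕ) : ℝ) := by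
  -- For `n ≥ 1` the constant `2 ^ 15` is absorbed into `(2 ^ n) ^ 15`, and `27 = 15 + 12`.
  refine ⟨2, 2 ^ 27, one_lt_two, by norm_num, ?_⟩
  filter_upwards [Filter.eventually_ge_atTop 1] with n hn
  push_cast
  have h1 : (1 : ℝ) ≤ 2 ^ n := one_le_pow₀ one_le_two
  have h2 : (2 : ℝ) ≤ 2 ^ n := le_self_pow₀ one_le_two (by omega)
  have h12 : (2 : ℝ) ^ n ≤ (2 ^ n) ^ 12 := le_self_pow₀ h1 (by norm_num)
  constructor
  · linarith
  · calc (16384 : ℝ) * (2 ^ n) ^ 12 + 2 ≤ 2 ^ 15 * (2 ^ n) ^ 12 := by linarith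
      _ ≤ (2 ^ n) ^ 15 * (2 ^ n) ^ 12 := by gcongr
      _ = (2 ^ 27) ^ n := by rw [← pow_add, ← pow_mul, ← pow_mul, mul_comm]

theorem mainTheorem2 :
    ∃ (m : ℕ → ℕ) (q : ℕ → ℝ),
      IsExponential (fun n => (m n : ℝ)) ∧ IsExponential q ∧ (∀ n, 2 ≤ m n) ∧
      ∀ (n : ℕ) (ρ : Matrix (Fin (m n) → Fin (2 ^ n)) (Fin (m n) → Fin (2 ^ n)) ℂ),
        IsSymmetricState ρ →
        ∃ δ : ℝ, IsLeast ((fun σ => traceNorm (reducedTwo ρ - σ)) '' separableStates (2 ^ n)) δ ∧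
          δ < 1 / q n := by
  -- With `K = 2 ^ 14 * d ^ 12`, the squared trace norm is at most `(d ^ 2) ^ 3 * (8 * d) ^ 4 / K =
  -- 1 / (4 * d ^ 2)`, strictly below `1 / d ^ 2`. The `+ 2` counts the kept sites.
  refine ⟨fun n => 16384 * (2 ^ n) ^ 12 + 2, fun n => 2 ^ n, isExponential_numberOfSites,
    isExponential_two_pow, fun n => Nat.le_add_left _ _, fun n ρ hρ => ?_⟩
  obtain ⟨σ, hσ, hle⟩ := exists_separable_entry_le (by positivity) hρ
  refine exists_isLeast_traceNorm_sub _ hσ (lt_of_pow_lt_pow_left₀ 2 (by positivity) ?_)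
  refine (traceNorm_sq_le_of_entry_le _ hle).trans_lt ?_
  have hd : (0 : ℝ) < 2 ^ n := by positivity
  rw [Fintype.card_prod, Fintype.card_fin]
  push_cast
  generalize (2 : ℝ) ^ n = d at hd
  have h : (d * d) ^ 3 * ((8 * d) ^ 4 / (16384 * d ^ 12)) = (1 / 4) * (1 / d) ^ 2 := by
    field_simp
    norm_num
  rw [h]
  have : 0 < (1 / d) ^ 2 := by positivity
  linarith
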